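/- **Setting.** Fix disjoint sets of addresses $Adr$, threads, data values $Dom$ (with default value $0$ and a comparison $<$), pointer variables $PVar$, data variables $DVar$ and library functions. Pointer expressions are $PVar\uplus\{a.\mathtt{next}\mid a\in Adr\}$ and data expressions are $DVar\uplus\{a.\mathtt{data}\mid a\in Adr\}$. A memory $m$ maps, partially, pointer expressions to $Adr\uplus\{\mathtt{seg}\}$ and data expressions to $Dom$; write $m(P)$ for the set of addresses that are values of $m$ on a set $P$ of pointer expressions. The restriction $m|_P$ keeps $P$, $DVar$ and the $a.\mathtt{data}$ with $a\in m(P)$; $adr(m)$ is the set of addresses that are values of $m$ or have a selector in the domain of $m$. A program $P$ assigns to every thread a control-flow graph (initial location; a partial function giving the location reached by a command) over the commands $p:=q$, $p.\mathtt{next}:=q$, $p:=q.\mathtt{next}$, $x:=op(\vec y)$, $p.\mathtt{data}:=y$, $x:=q.\mathtt{data}$, $\mathtt{assert}\ c$ (with $c$ one of $p=q$, $p\neq q$, $x=y$, $x\neq y$, $x<y$), $p:=\mathtt{malloc}$, $\mathtt{enter}\,f(\vec p,\vec x)$, $\mathtt{exit}$. An observer $\mathcal O$ is an automaton over events $f(t,\vec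 a,\vec d)$, $\mathtt{exit}(t)$, $\mathtt{free}(a)$ with transitions guarded by Boolean combinations of equalities between observer variables (whose arbitrary valuation is chosen initially and kept) and event parameters; $Spec(\mathcal O)$ is the set of histories (event sequences) that no initial state accepts. Let $F(h,a)=\{h'\mid h.h'\in Spec(\mathcal O),\ \text{all free events of } h' \text{ free } a\}$. A computation is a sequence of actions (thread, command, memory update); $m_\tau$, $ctrl(\tau)$ and $H(\tau)$ are the memory, the control locations of the threads and the induced history after $\tau$ (the history of $\mathtt{enter}$, $\mathtt{exit}$ and $\mathtt{free}$ actions with actual parameters). Initially pointer variables are $\mathtt{seg}$, data variables are $0$, selectors are undefined. $fresh(\tau)$ are the addresses never allocated or freed, $freed(\tau)$ those freed since their last allocation. For $X\subseteq Adr$, $[\![\mathcal O]\!]_X$ is the set of computations that respect control flow and in which commands have their usual effect; $\mathtt{malloc}$ returns an address $a\in fresh(\tau)\cup(freed(\tau)\cap X)$, setting $a.\mathtt{next}$ to $\mathtt{seg}$ and $a.\mathtt{data}$ arbitrarily; dereferenced pointers and pointer parameters of calls must hold addresses; and the environment may execute $\mathtt{free}(a)$, which makes the selectors of $a$ undefined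 and does not change control, whenever $H(\tau).\mathtt{free}(a)\in Spec(\mathcal O)$. The full semantics is $[\![\mathcal O]\!]_{Adr}$; the single-reuse semantics is $[\![\mathcal O]\!]_{one}=\bigcup_{a\in Adr}[\![\mathcal O]\!]_{\{a\}}$. The set $valid(\tau)$ of valid pointer expressions is $PVar$ initially; an assignment to a pointer expression makes it valid or invalid according to the validity of its right-hand side; $\mathtt{free}(a)$ invalidates $a.\mathtt{next}$ and all pointer expressions with value $a$; $p:=\mathtt{malloc}$ returning $a$ validates $p$ and $a.\mathtt{next}$; $\mathtt{assert}\ p=q$ validates both $p$ and $q$ if one of them is valid; nothing else changes validity. **Relations.** Write $F(\tau,a)=F(H(\tau),a)$. - $\tau\sim\sigma$ iff $ctrl(\tau)=ctrl(\sigma)$ and $m_\tau|_{valid(\tau)}=m_\sigma|_{valid(\sigma)}$. - $\tau\lessdot\sigma$ iff $F(\tau,c)\subseteq F(\sigma,c)$ for all $c\in adr(m_\tau|_{valid(\tau)})$. - $\tau\equiv_a\sigma$ iff for all $p\in PVar$: $m_\tau(p)=a\Leftrightarrow m_\sigma(p)=a$; for all $b\in m_\tau(valid(\tau))$: $m_\tau(b.\mathtt{next})=a\Leftrightarrow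 m_\sigma(b.\mathtt{next})=a$; $a\in fresh(\tau)\cup freed(\tau)\Leftrightarrow a\in fresh(\sigma)\cup freed(\sigma)$; and $F(\tau,a)\subseteq F(\sigma,a)$. **Pointer race freedom.** $[\![\mathcal O]\!]_{one}$ is pointer race free if for no $\tau.act\in[\![\mathcal O]\!]_{one}$ (i) $act$ dereferences some $p\notin valid(\tau)$, or (ii) $act$ is a call $\mathtt{enter}\,f(\vec p,\vec x)$ by a thread $t$ with $m_\tau(\vec p)=\vec a$, $m_\tau(\vec x)=\vec d$, and there are $c\in Adr$, $\vec b$ such that $a_i=b_i$ whenever $a_i=c$ or $p_i\in valid(\tau)$, and $F(H(\tau).f(t,\vec b,\vec d),c)\not\subseteq F(H(\tau).f(t,\vec a,\vec d),c)$. **Reduction compatibility.** $[\![\mathcal O]\!]_{one}$ is reduction compatible if 1. for all addresses $a\neq b$, all $\tau.act\in[\![\mathcal O]\!]_{Adr}$, $\sigma_a.act\in[\![\mathcal O]\!]_{\{a\}}$ and $\sigma_b\in[\![\mathcal O]\!]_{\{b\}}$ where $act$ is an assertion or an allocation of $a$: if $\tau\prec\sigma_a$ and $\tau.act\prec\sigma_a.act$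 for each $\prec\,\in\{\sim,\lessdot,\equiv_a\}$, $\tau\prec\sigma_b$ for each $\prec\,\in\{\sim,\lessdot,\equiv_b\}$, and $\sigma_a\sim\sigma_b$, then there is $\sigma_b'\in[\![\mathcal O]\!]_{\{b\}}$ with $\tau.act\sim\sigma_b'$, $\tau.act\lessdot\sigma_b'$ and $\tau.act\equiv_b\sigma_b'$; and 2. $F(h.\mathtt{free}(a),b)=F(h,b)$ for all histories $h$ and addresses $a\neq b$. **Proposition.** Let $[\![\mathcal O]\!]_{one}$ be reduction compatible and pointer race free. Then for all $\tau\in[\![\mathcal O]\!]_{Adr}$ and all $a\in Adr$ there is $\sigma\in[\![\mathcal O]\!]_{one}$ with $\tau\sim\sigma$, $\tau\equiv_a\sigma$, and observer behavior inclusion on all valid addresses and on $a$: $\tau\lessdot\sigma$ and $F(\tau,a)\subseteq F(\sigma,a)$. -/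

import Mathlib

universe u v w

namespace SMR

/-- The basic sets that programs are built from: addresses, threads, data values (with the default
value `0` and the comparison `<` used in assertions), pointer and data variables, and the functions
offered by the memory reclamation library with the numbers of their pointer and data parameters. -/
structure Signature where
  Adr : Type u
  Thread : Type u
  Dom : Type u
  zero : Dom
  lt : Dom → Dom → Prop
  PVar : Type u
  DVar : Type u
  Func : Type u
  pArity : Func → ℕ
  dArity : Func → ℕ

variable {S : Signature.{u}}

/-! ### Memory -/

/-- Pointer expressions: pointer variables `p` and pointer selectors `a.next`. -/
inductive PExp (S : Signature.{u}) : Type u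
  | var (p : S.PVar)
  | sel (a : S.Adr)

/-- Data expressions: data variables `x` and data selectors `a.data`. -/
inductive DExp (S : Signature.{u}) : Type u
  | var (x : S.DVar)
  | sel (a : S.Adr)

/-- Pointer values: `seg` (uninitialized) or an address. -/
inductive PVal (S : Signature.{u}) : Type u
  | seg
  | adr (a : S.Adr)

/-- A memory: a partial function on pointer and data expressions; `none` is "undefined". -/
@[ext]
structure Mem (S : Signature.{u}) : Type u where
  ptr : PExp S → Option (PVal S)
  dat : DExp S → Option S.Dom

/-- One entry `[e ↦ v]` of a memory update; `none` makes the expression undefined. -/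
inductive Upd (S : Signature.{u}) : Type u
  | ptr (e : PExp S) (v : Option (PVal S))
  | dat (e : DExp S) (v : Option S.Dom)

open Classical in
/-- `m[e ↦ v]`. -/
noncomputable def Mem.set (m : Mem S) : Upd S → Mem S
  | .ptr e v => { m with ptr := Function.update m.ptr e v }
  | .dat e v => { m with dat := Function.update m.dat e v }

/-- `m[up]`, for an update with finitely many entries. -/
noncomputable def Mem.apply (m : Mem S) (up : List (Upd S)) : Mem S :=
  up.foldl Mem.set m

/-- The initial memory. -/
def Mem.init (S : Signature.{u}) : Mem S where
  ptr
    | .var _ => some .seg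
    | .sel _ => none
  dat
    | .var _ => some S.zero
    | .sel _ => none

/-- The lifting of a memory to a set `E` of pointer expressions, `m(E)`, without `seg`. -/
def Mem.adrsAt (m : Mem S) (E : Set (PExp S)) : Set S.Adr :=
  {a | ∃ e ∈ E, m.ptr e = some (.adr a)}

/-- The in-use addresses: those in the range of `m`, and those with a selector in its domain. -/
def Mem.inUse (m : Mem S) : Set S.Adr :=
  {a | (∃ e, m.ptr e = some (.adr a)) ∨ m.ptr (.sel a) ≠ none ∨ m.dat (.sel a) ≠ none}

open Classical in
/-- The restriction of `m` to a set `E` of pointer expressions: it keeps the expressions in `E`, all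
data variables, and the data selectors of the addresses in `m(E)`. -/
noncomputable def Mem.restrict (m : Mem S) (E : Set (PExp S)) : Mem S where
  ptr e := if e ∈ E then m.ptr e else none
  dat
    | .var x => m.dat (.var x)
    | .sel a => if a ∈ m.adrsAt E then m.dat (.sel a) else none

/-! ### Commands, actions, computations -/

/-- Conditions of assertions. -/
inductive Cond (S : Signature.{u}) : Type u
  | ptrEq (p q : S.PVar)
  | ptrNe (p q : S.PVar)
  | datEq (x y : S.DVar)
  | datNe (x y : S.DVar)
  | datLt (x y : S.DVar)

def Cond.Holds (m : Mem S) : Cond S → Prop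
  | .ptrEq p q => m.ptr (.var p) = m.ptr (.var q)
  | .ptrNe p q => m.ptr (.var p) ≠ m.ptr (.var q)
  | .datEq x y => m.dat (.var x) = m.dat (.var y)
  | .datNe x y => m.dat (.var x) ≠ m.dat (.var y)
  | .datLt x y => ∃ d e, m.dat (.var x) = some d ∧ m.dat (.var y) = some e ∧ S.lt d e

/-- The commands of data structures. Memory is freed by the environment only. -/
inductive Com (S : Signature.{u}) : Type u
  /-- `p := q` -/
  | ptrCopy (p q : S.PVar)
  /-- `p.next := q` -/
  | ptrStore (p q : S.PVar)
  /-- `p := q.next` -/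
  | ptrLoad (p q : S.PVar)
  /-- `x := op(ys)` -/
  | datOp (x : S.DVar) (op : List S.Dom → S.Dom) (ys : List S.DVar)
  /-- `p.data := y` -/
  | datStore (p : S.PVar) (y : S.DVar)
  /-- `x := q.data` -/
  | datLoad (x : S.DVar) (q : S.PVar)
  /-- `assert c` -/
  | assert (c : Cond S)
  /-- `p := malloc` -/
  | malloc (p : S.PVar)
  /-- `enter f(ps, xs)` -/
  | enter (f : S.Func) (ps : Fin (S.pArity f) → S.PVar) (xs : Fin (S.dArity f) → S.DVar)
  /-- `exit` -/
  | exit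

/-- What an action executes: a command of the data structure, or the environment step `free(a)`. -/
inductive Label (S : Signature.{u}) : Type u
  | com (c : Com S)
  | free (a : S.Adr)

/-- An action `(t, com, up)`. -/
structure Action (S : Signature.{u}) : Type u where
  thread : S.Thread
  label : Label S
  up : List (Upd S)

/-- Sequences of actions, latest action first: `act :: τ` is the computation `τ.act`. -/
abbrev Comp (S : Signature.{u}) : Type u := List (Action S)

/-- The memory after a computation. -/
noncomputable def heap : Comp S → Mem S
  | [] => Mem.init S
  | act :: τ => (heap τ).apply act.up

/-- The fresh addresses: never allocated and never freed. -/
def fresh : Comp S → Set S.Adr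
  | [] => Set.univ
  | act :: τ =>
    match act.label with
    | .free a => fresh τ \ {a}
    | .com (.malloc p) => fresh τ \ {a | (heap (act :: τ)).ptr (.var p) = some (.adr a)}
    | _ => fresh τ

/-- The freed addresses: freed since their last allocation. -/
def freed : Comp S → Set S.Adr
  | [] => ∅
  | act :: τ =>
    match act.label with
    | .free a => freed τ ∪ {a}
    | .com (.malloc p) => freed τ \ {a | (heap (act :: τ)).ptr (.var p) = some (.adr a)}
    | _ => freed τ

open Classical in
/-- The valid pointer expressions. -/
noncomputable def valid : Comp S → Set (PExp S)
  | [] => Set.range PExp.var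
  | act :: τ =>
    match act.label with
    | .com (.ptrCopy p q) =>
      if .var q ∈ valid τ then valid τ ∪ {.var p} else valid τ \ {.var p}
    | .com (.ptrStore p q) =>
      match (heap τ).ptr (.var p) with
      | some (.adr a) => if .var q ∈ valid τ then valid τ ∪ {.sel a} else valid τ \ {.sel a}
      | _ => valid τ
    | .com (.ptrLoad p q) =>
      match (heap τ).ptr (.var q) with
      | some (.adr a) => if .sel a ∈ valid τ then valid τ ∪ {.var p} else valid τ \ {.var p}
      | _ => valid τ
    | .free a => valid τ \ ({e | (heap τ).ptr e = some (.adr a)} ∪ {.sel a})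
    | .com (.malloc p) =>
      valid τ ∪ {e | ∃ a, Upd.ptr (.var p) (some (.adr a)) ∈ act.up ∧ (e = .var p ∨ e = .sel a)}
    | .com (.assert (.ptrEq p q)) =>
      if .var p ∈ valid τ ∨ .var q ∈ valid τ then valid τ ∪ {.var p, .var q} else valid τ
    | _ => valid τ

/-- The valid addresses: the in-use addresses of the memory restricted to the valid pointers. -/
noncomputable def validAdr (τ : Comp S) : Set S.Adr :=
  ((heap τ).restrict (valid τ)).inUse

/-! ### Histories and observers -/

/-- Events: calls of library functions, returns from such calls, and frees. -/
inductive Event (S : Signature.{u}) : Type u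
  | call (f : S.Func) (t : S.Thread) (as : Fin (S.pArity f) → S.Adr) (ds : Fin (S.dArity f) → S.Dom)
  | exit (t : S.Thread)
  | free (a : S.Adr)

/-- Histories, in chronological order. -/
abbrev History (S : Signature.{u}) : Type u := List (Event S)

/-- The address held by pointer variable `p`, if any. -/
def Mem.adr? (m : Mem S) (p : S.PVar) : Option S.Adr :=
  match m.ptr (.var p) with
  | some (.adr a) => some a
  | _ => none

open Classical in
/-- The history induced by a computation. An `enter` emits its call event with the values of the
parameters; within the semantics below these values are always defined. -/
noncomputable def history : Comp S → History S
  | [] => []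
  | act :: τ =>
    match act.label with
    | .free a => history τ ++ [.free a]
    | .com (.enter f ps xs) =>
      if h : (∀ i, ((heap τ).adr? (ps i)).isSome) ∧ ∀ j, ((heap τ).dat (.var (xs j))).isSome then
        history τ ++ [.call f act.thread (fun i => ((heap τ).adr? (ps i)).get (h.1 i))
          (fun j => ((heap τ).dat (.var (xs j))).get (h.2 j))]
      else history τ
    | .com .exit => history τ ++ [.exit act.thread]
    | _ => history τ

/-- The addresses that are freed in a history. -/
def frees (h : History S) : Set S.Adr := {a | Event.free a ∈ h}

/-- Values that observers compare. -/
inductive Value (S : Signature.{u}) : Type u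
  | thread (t : S.Thread)
  | adr (a : S.Adr)
  | data (d : S.Dom)

/-- Event types. -/
inductive EvType (S : Signature.{u}) : Type u
  | func (f : S.Func)
  | exit
  | free

def Event.type : Event S → EvType S
  | .call f _ _ _ => .func f
  | .exit _ => .exit
  | .free _ => .free

/-- The actual parameters of an event. -/
def Event.args : Event S → List (Value S)
  | .call _ t as ds => .thread t :: (List.ofFn fun i => .adr (as i)) ++ List.ofFn fun j => .data (ds j)
  | .exit t => [.thread t]
  | .free a => [.adr a]

/-- Terms of guards: observer variables, and formal parameters given by their position. -/
inductive Term (V : Type w) : Type w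
  | var (x : V)
  | param (i : ℕ)

/-- Guards: Boolean formulas over equalities of observer variables and parameters. -/
inductive Guard (V : Type w) : Type w
  | tru
  | eq (s t : Term V)
  | not (g : Guard V)
  | and (g h : Guard V)
  | or (g h : Guard V)

def Term.eval {V : Type w} (φ : V → Value S) (args : List (Value S)) : Term V → Option (Value S)
  | .var x => some (φ x)
  | .param i => args[i]?

def Guard.Holds {V : Type w} (φ : V → Value S) (args : List (Value S)) : Guard V → Prop
  | .tru => True
  | .eq s t => ∃ x, s.eval φ args = some x ∧ t.eval φ args = some x
  | .not g => ¬ g.Holds φ args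
  | .and g h => g.Holds φ args ∧ h.Holds φ args
  | .or g h => g.Holds φ args ∨ h.Holds φ args

/-- Observer automata. -/
structure Observer (S : Signature.{u}) where
  Loc : Type w
  Var : Type w
  init : Loc
  accepting : Set Loc
  trans : Set (Loc × EvType S × Guard Var × Loc)

namespace Observer

variable (O : Observer.{u, w} S)

/-- Observer states. -/
abbrev State := O.Loc × (O.Var → Value S)

/-- Observer steps; they do not change the valuation of the observer variables. -/
def Step (s : O.State) (e : Event S) (s' : O.State) : Prop :=
  s'.2 = s.2 ∧ ∃ g, (s.1, e.type, g, s'.1) ∈ O.trans ∧ g.Holds s.2 e.args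

/-- Sequences of observer steps. -/
inductive Steps : O.State → History S → O.State → Prop
  | nil (s : O.State) : Steps s [] s
  | cons {s s' s'' : O.State} {e : Event S} {h : History S} :
      O.Step s e s' → Steps s' h s'' → Steps s (e :: h) s''

/-- The specification of a state: the histories it does not accept. -/
def stateSpec (s : O.State) : Set (History S) :=
  {h | ∀ s', O.Steps s h s' → s'.1 ∉ O.accepting}

/-- The specification of the observer: the histories that no initial state accepts. -/
def spec : Set (History S) :=
  {h | ∀ φ : O.Var → Value S, h ∈ O.stateSpec (O.init, φ)}

/-- The behavior allowed on address `a` after history `h`. -/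
def freeable (h : History S) (a : S.Adr) : Set (History S) :=
  {h' | h ++ h' ∈ O.spec ∧ frees h' ⊆ {a}}

end Observer

/-! ### Programs and their semantics -/

/-- The control flow of a data structure: initial control locations of the threads, and the location
that a thread reaches by executing a command, if the control flow admits that command. -/
structure Program (S : Signature.{u}) where
  Loc : Type v
  init : S.Thread → Loc
  next : S.Thread → Loc → Com S → Option Loc

open Classical in
/-- The control locations of the threads after a computation; environment steps leave them
unchanged. -/
noncomputable def ctrl (P : Program.{u, v} S) : Comp S → S.Thread → P.Loc
  | [] => P.init
  | act :: τ =>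
    match act.label with
    | .free _ => ctrl P τ
    | .com c =>
      match P.next act.thread (ctrl P τ act.thread) c with
      | some l => Function.update (ctrl P τ) act.thread l
      | none => ctrl P τ

/-- `Exec X τ c up`: after `τ`, command `c` can be executed with memory update `up`, where only the
addresses in `X` may be reused. -/
inductive Exec (X : Set S.Adr) (τ : Comp S) : Com S → List (Upd S) → Prop
  | malloc (p : S.PVar) (a : S.Adr) (d : S.Dom) :
      a ∈ fresh τ ∪ (freed τ ∩ X) →
      Exec X τ (.malloc p)
        [.ptr (.var p) (some (.adr a)), .ptr (.sel a) (some .seg), .dat (.sel a) (some d)]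
  | enter (f : S.Func) (ps : Fin (S.pArity f) → S.PVar) (xs : Fin (S.dArity f) → S.DVar) :
      (∀ i, ∃ a, (heap τ).ptr (.var (ps i)) = some (.adr a)) →
      (∀ j, ∃ d, (heap τ).dat (.var (xs j)) = some d) →
      Exec X τ (.enter f ps xs) []
  | exit : Exec X τ .exit []
  | ptrCopy (p q : S.PVar) :
      Exec X τ (.ptrCopy p q) [.ptr (.var p) ((heap τ).ptr (.var q))]
  | ptrStore (p q : S.PVar) (a : S.Adr) :
      (heap τ).ptr (.var p) = some (.adr a) →
      Exec X τ (.ptrStore p q) [.ptr (.sel a) ((heap τ).ptr (.var q))]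
  | ptrLoad (p q : S.PVar) (a : S.Adr) :
      (heap τ).ptr (.var q) = some (.adr a) →
      Exec X τ (.ptrLoad p q) [.ptr (.var p) ((heap τ).ptr (.sel a))]
  | datOp (x : S.DVar) (op : List S.Dom → S.Dom) (ys : List S.DVar) (ds : List S.Dom) :
      ys.map (fun y => (heap τ).dat (.var y)) = ds.map some →
      Exec X τ (.datOp x op ys) [.dat (.var x) (some (op ds))]
  | datStore (p : S.PVar) (y : S.DVar) (a : S.Adr) :
      (heap τ).ptr (.var p) = some (.adr a) →
      Exec X τ (.datStore p y) [.dat (.sel a) ((heap τ).dat (.var y))]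
  | datLoad (x : S.DVar) (q : S.PVar) (a : S.Adr) :
      (heap τ).ptr (.var q) = some (.adr a) →
      Exec X τ (.datLoad x q) [.dat (.var x) ((heap τ).dat (.sel a))]
  | assert (c : Cond S) : c.Holds (heap τ) → Exec X τ (.assert c) []

/-- The computations of `P` in which only addresses from `X` are reused and in which the environment
frees whatever the observer `O` allows to be freed. -/
inductive IsComp (P : Program.{u, v} S) (O : Observer.{u, w} S) (X : Set S.Adr) : Comp S → Prop
  | nil : IsComp P O X []
  | com {τ : Comp S} (t : S.Thread) (c : Com S) (up : List (Upd S)) :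
      IsComp P O X τ → (P.next t (ctrl P τ t) c).isSome → Exec X τ c up →
      IsComp P O X (⟨t, .com c, up⟩ :: τ)
  | free {τ : Comp S} (t : S.Thread) (a : S.Adr) :
      IsComp P O X τ → history τ ++ [.free a] ∈ O.spec →
      IsComp P O X (⟨t, .free a, [.ptr (.sel a) none, .dat (.sel a) none]⟩ :: τ)

def sem (P : Program.{u, v} S) (O : Observer.{u, w} S) (X : Set S.Adr) : Set (Comp S) :=
  {τ | IsComp P O X τ}

/-- The full semantics: every address may be reused. -/
def fullSem (P : Program.{u, v} S) (O : Observer.{u, w} S) : Set (Comp S) := sem P O Set.univ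

/-- The single-reuse semantics: at most one address is reused per computation. -/
def oneSem (P : Program.{u, v} S) (O : Observer.{u, w} S) : Set (Comp S) := ⋃ a, sem P O {a}

/-! ### Relations among computations -/

/-- `τ ∼ σ`: same control locations and same valid memory. -/
def Similar (P : Program.{u, v} S) (τ σ : Comp S) : Prop :=
  ctrl P τ = ctrl P σ ∧ (heap τ).restrict (valid τ) = (heap σ).restrict (valid σ)

/-- `F(τ, c) ⊆ F(σ, c)`: behavior inclusion on a single address `c`. -/
def InclOn (O : Observer.{u, w} S) (c : S.Adr) (τ σ : Comp S) : Prop :=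
  O.freeable (history τ) c ⊆ O.freeable (history σ) c

/-- `σ` includes the observer behavior of `τ` on all valid addresses of `τ`. -/
def ObsIncl (O : Observer.{u, w} S) (τ σ : Comp S) : Prop :=
  ∀ c ∈ validAdr τ, InclOn O c τ σ

/-- `τ` and `σ` are memory equivalent with respect to address `a`. -/
def MemEquiv (O : Observer.{u, w} S) (a : S.Adr) (τ σ : Comp S) : Prop :=
  (∀ p : S.PVar,
    (heap τ).ptr (.var p) = some (.adr a) ↔ (heap σ).ptr (.var p) = some (.adr a)) ∧
  (∀ b ∈ (heap τ).adrsAt (valid τ),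
    (heap τ).ptr (.sel b) = some (.adr a) ↔ (heap σ).ptr (.sel b) = some (.adr a)) ∧
  (a ∈ fresh τ ∪ freed τ ↔ a ∈ fresh σ ∪ freed σ) ∧
  InclOn O a τ σ

/-! ### Pointer races and reduction compatibility -/

/-- `c.Derefs p`: the command contains `p.next` or `p.data`. -/
def Com.Derefs (p : S.PVar) : Com S → Prop
  | .ptrStore p' _ => p' = p
  | .ptrLoad _ q => q = p
  | .datStore p' _ => p' = p
  | .datLoad _ q => q = p
  | _ => False

/-- `τ.act` performs an unsafe access. -/
def UnsafeAccess (τ : Comp S) (act : Action S) : Prop :=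
  ∃ c p, act.label = .com c ∧ c.Derefs p ∧ PExp.var p ∉ valid τ

/-- `τ.act` performs a racy call. -/
def RacyCall (O : Observer.{u, w} S) (τ : Comp S) (act : Action S) : Prop :=
  ∃ (f : S.Func) (ps : Fin (S.pArity f) → S.PVar) (xs : Fin (S.dArity f) → S.DVar)
    (as : Fin (S.pArity f) → S.Adr) (ds : Fin (S.dArity f) → S.Dom),
    act.label = .com (.enter f ps xs) ∧
    (∀ i, (heap τ).ptr (.var (ps i)) = some (.adr (as i))) ∧
    (∀ j, (heap τ).dat (.var (xs j)) = some (ds j)) ∧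
    ∃ (c : S.Adr) (bs : Fin (S.pArity f) → S.Adr),
      (∀ i, as i = c ∨ PExp.var (ps i) ∈ valid τ → as i = bs i) ∧
      ¬ O.freeable (history τ ++ [.call f act.thread bs ds]) c ⊆
          O.freeable (history τ ++ [.call f act.thread as ds]) c

/-- `τ.act` is a pointer race. -/
def PointerRace (O : Observer.{u, w} S) (τ : Comp S) (act : Action S) : Prop :=
  UnsafeAccess τ act ∨ RacyCall O τ act

/-- The single-reuse semantics is pointer race free. -/
def PointerRaceFree (P : Program.{u, v} S) (O : Observer.{u, w} S) : Prop :=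
  ∀ (τ : Comp S) (act : Action S), act :: τ ∈ oneSem P O → ¬ PointerRace O τ act

/-- The action is an assertion, or an allocation of address `a`. -/
def AssertOrMalloc (a : S.Adr) (act : Action S) : Prop :=
  (∃ c, act.label = .com (.assert c)) ∨
    ∃ p, act.label = .com (.malloc p) ∧ Upd.ptr (.var p) (some (.adr a)) ∈ act.up

/-- The single-reuse semantics is reduction compatible. -/
def ReductionCompatible (P : Program.{u, v} S) (O : Observer.{u, w} S) : Prop :=
  (∀ (a b : S.Adr) (act : Action S) (τ σa σb : Comp S),
    act :: τ ∈ fullSem P O → act :: σa ∈ sem P O {a} → σb ∈ sem P O {b} →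
    Similar P τ σa → ObsIncl O τ σa → MemEquiv O a τ σa →
    Similar P (act :: τ) (act :: σa) → ObsIncl O (act :: τ) (act :: σa) →
    MemEquiv O a (act :: τ) (act :: σa) →
    Similar P τ σb → ObsIncl O τ σb → MemEquiv O b τ σb →
    Similar P σa σb → a ≠ b → AssertOrMalloc a act →
    ∃ σb' ∈ sem P O {b},
      Similar P (act :: τ) σb' ∧ ObsIncl O (act :: τ) σb' ∧ MemEquiv O b (act :: τ) σb') ∧
  (∀ (h : History S) (a b : S.Adr), a ≠ b →
    O.freeable (h ++ [.free a]) b = O.freeable h b)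

end SMR

/-! By induction on the computation `τ` of the full semantics, it is shown that `τ` makes no unsafe
access and that for every address `a` there is a computation `σ` that reuses only `a` and satisfies
`Corr P O a τ σ`, which packages the three relations (`safe_and_exists_corr`). The quantifier over
all `a` inside the induction hypothesis is what makes the induction work.

Valid memory coincides in `τ` and `σ`; invalid pointers may differ, but they agree on whether they
hold `a`. An unsafe access in `τ` through a pointer to `b` could therefore be repeated in the
computation for `b`, against race freedom. Safe commands other than assertions and allocations are
mimicked directly. For calls, race freedom says that the observer does not depend on the differing
arguments, because an address other than `a` is never reused and so has no dangling pointers while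
it is allocated (`Corr.enter`).

Assertions and allocations may depend on a particular address `b`. They are executed in the
computation for `b`, and reduction compatibility transfers the result to the computation for `a`
(`exists_corr_of_compatible`). A `free(b)` is repeated if the observer behavior of `σ` on `b` allows
it; otherwise `b` is neither valid nor equal to `a`, and `σ` can skip the step (`Corr.free_left`).
-/

namespace SMR

variable {S : Signature.{u}}

/-! ### Unfolding lemmas -/

@[simp] theorem Mem.apply_nil (m : Mem S) : m.apply [] = m := rfl

@[simp] theorem Mem.apply_cons (m : Mem S) (u : Upd S) (us : List (Upd S)) :
    m.apply (u :: us) = (m.set u).apply us := rfl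

open Classical in
@[simp] theorem Mem.set_ptr_ptr (m : Mem S) (e e' : PExp S) (v : Option (PVal S)) :
    (m.set (.ptr e v)).ptr e' = if e' = e then v else m.ptr e' := by
  simp [Mem.set, Function.update_apply]

@[simp] theorem Mem.set_ptr_dat (m : Mem S) (e : PExp S) (v : Option (PVal S)) :
    (m.set (.ptr e v)).dat = m.dat := rfl

open Classical in
@[simp] theorem Mem.set_dat_dat (m : Mem S) (e e' : DExp S) (v : Option S.Dom) :
    (m.set (.dat e v)).dat e' = if e' = e then v else m.dat e' := by
  simp [Mem.set, Function.update_apply]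

@[simp] theorem Mem.set_dat_ptr (m : Mem S) (e : DExp S) (v : Option S.Dom) :
    (m.set (.dat e v)).ptr = m.ptr := rfl

@[simp] theorem heap_cons (act : Action S) (τ : Comp S) :
    heap (act :: τ) = (heap τ).apply act.up := rfl

section Valid

variable {τ : Comp S} {t : S.Thread} {up : List (Upd S)}

open Classical in
theorem mem_valid_ptrCopy {p q : S.PVar} {e : PExp S} :
    e ∈ valid (⟨t, .com (.ptrCopy p q), up⟩ :: τ) ↔
      if e = .var p then .var q ∈ valid τ else e ∈ valid τ := by
  simp only [valid]; split_ifs <;> simp_all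

open Classical in
theorem mem_valid_ptrStore {p q : S.PVar} {a : S.Adr} {e : PExp S}
    (h : (heap τ).ptr (.var p) = some (.adr a)) :
    e ∈ valid (⟨t, .com (.ptrStore p q), up⟩ :: τ) ↔
      if e = .sel a then .var q ∈ valid τ else e ∈ valid τ := by
  simp only [valid, h]; split_ifs <;> simp_all

open Classical in
theorem mem_valid_ptrLoad {p q : S.PVar} {a : S.Adr} {e : PExp S}
    (h : (heap τ).ptr (.var q) = some (.adr a)) :
    e ∈ valid (⟨t, .com (.ptrLoad p q), up⟩ :: τ) ↔
      if e = .var p then .sel a ∈ valid τ else e ∈ valid τ := by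
  simp only [valid, h]; split_ifs <;> simp_all

theorem mem_valid_free {a : S.Adr} {e : PExp S} :
    e ∈ valid (⟨t, .free a, up⟩ :: τ) ↔
      e ∈ valid τ ∧ (heap τ).ptr e ≠ some (.adr a) ∧ e ≠ .sel a := by
  simp [valid]; grind

theorem mem_valid_malloc {p : S.PVar} {a : S.Adr} {d : S.Dom} {e : PExp S} :
    e ∈ valid (⟨t, .com (.malloc p), [.ptr (.var p) (some (.adr a)),
        .ptr (.sel a) (some .seg), .dat (.sel a) (some d)]⟩ :: τ) ↔
      e ∈ valid τ ∨ e = .var p ∨ e = .sel a := by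
  simp [valid]

theorem mem_valid_assert_ptrEq {p q : S.PVar} {e : PExp S} :
    e ∈ valid (⟨t, .com (.assert (.ptrEq p q)), up⟩ :: τ) ↔
      e ∈ valid τ ∨
        ((.var p ∈ valid τ ∨ .var q ∈ valid τ) ∧ (e = .var p ∨ e = .var q)) := by
  simp only [valid]; split_ifs <;> simp_all
  tauto

end Valid

/-! ### Invariants of safe computations -/

/-- No action of the computation is an unsafe access. -/
def Safe : Comp S → Prop
  | [] => True
  | act :: τ => ¬ UnsafeAccess τ act ∧ Safe τ

theorem Safe.valid_of_derefs {τ : Comp S} {t : S.Thread} {c : Com S} {up : List (Upd S)}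
    {p : S.PVar} (h : Safe (⟨t, .com c, up⟩ :: τ)) (hp : c.Derefs p) : PExp.var p ∈ valid τ := by
  by_contra hv
  exact h.1 ⟨c, p, rfl, hp, hv⟩

/-- Invariants of safe computations. -/
structure WellFormed (τ : Comp S) : Prop where
  defined : ∀ e ∈ valid τ, (heap τ).ptr e ≠ none
  seg : ∀ e, (heap τ).ptr e = some .seg → e ∈ valid τ
  var : ∀ p, (heap τ).ptr (.var p) ≠ none
  next : ∀ e ∈ valid τ, ∀ a, (heap τ).ptr e = some (.adr a) → (heap τ).ptr (.sel a) ≠ none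

variable {P : Program.{u, v} S} {O : Observer.{u, w} S} {X : Set S.Adr}

theorem wellFormed_cons_of_eq {τ : Comp S} {act : Action S} (h : WellFormed τ)
    (hv : valid (act :: τ) = valid τ) (hp : (heap (act :: τ)).ptr = (heap τ).ptr) :
    WellFormed (act :: τ) := by
  constructor <;> rw [hp]
  · rw [hv]; exact h.defined
  · rw [hv]; exact h.seg
  · exact h.var
  · rw [hv]; exact h.next

/-- Safety matters for loads `p := q.next`: since `q` is valid, `next` provides a defined value for
`p`. -/
theorem Exec.wellFormed {τ : Comp S} {t : S.Thread} {c : Com S} {up : List (Upd S)}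
    (hx : Exec X τ c up) (hs : Safe (⟨t, .com c, up⟩ :: τ)) (h : WellFormed τ) :
    WellFormed (⟨t, .com c, up⟩ :: τ) := by
  obtain ⟨h1, h2, h3, h4⟩ := h
  cases hx with
  | malloc p a d ha =>
    constructor <;> simp only [mem_valid_malloc, heap_cons, Mem.apply_cons, Mem.apply_nil,
      Mem.set_ptr_ptr, Mem.set_dat_ptr] <;> grind
  | enter f ps xs => exact wellFormed_cons_of_eq ⟨h1, h2, h3, h4⟩ rfl rfl
  | exit => exact wellFormed_cons_of_eq ⟨h1, h2, h3, h4⟩ rfl rfl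
  | ptrCopy p q =>
    constructor <;> simp only [mem_valid_ptrCopy, heap_cons, Mem.apply_cons, Mem.apply_nil,
      Mem.set_ptr_ptr] <;> grind
  | ptrStore p q a ha =>
    have hp := hs.valid_of_derefs (p := p) rfl
    constructor <;> simp only [mem_valid_ptrStore ha, heap_cons, Mem.apply_cons, Mem.apply_nil,
      Mem.set_ptr_ptr] <;> grind
  | ptrLoad p q a ha =>
    have hp := hs.valid_of_derefs (p := q) rfl
    constructor <;> simp only [mem_valid_ptrLoad ha, heap_cons, Mem.apply_cons, Mem.apply_nil,
      Mem.set_ptr_ptr] <;> grind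
  | datOp => exact wellFormed_cons_of_eq ⟨h1, h2, h3, h4⟩ rfl rfl
  | datStore => exact wellFormed_cons_of_eq ⟨h1, h2, h3, h4⟩ rfl rfl
  | datLoad => exact wellFormed_cons_of_eq ⟨h1, h2, h3, h4⟩ rfl rfl
  | assert c hc =>
    cases c with
    | ptrEq p q =>
      simp only [Cond.Holds] at hc
      constructor <;> simp only [mem_valid_assert_ptrEq, heap_cons, Mem.apply_nil] <;> grind
    | _ => exact wellFormed_cons_of_eq ⟨h1, h2, h3, h4⟩ rfl rfl

theorem IsComp.wellFormed {τ : Comp S} (hτ : IsComp P O X τ) (hs : Safe τ) : WellFormed τ := by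
  induction hτ with
  | nil =>
    constructor
    · rintro _ ⟨p, rfl⟩; simp [heap, Mem.init]
    · rintro (p | a) <;> simp [heap, Mem.init, valid]
    · simp [heap, Mem.init]
    · rintro _ ⟨p, rfl⟩; simp [heap, Mem.init]
  | com t c up _ _ hx ih => exact hx.wellFormed hs (ih hs.2)
  | free t a _ _ ih =>
    obtain ⟨h1, h2, h3, h4⟩ := ih hs.2
    constructor <;> simp only [mem_valid_free, heap_cons, Mem.apply_cons, Mem.apply_nil,
      Mem.set_ptr_ptr, Mem.set_dat_ptr] <;> grind

theorem safe_of_pointerRaceFree (hrace : PointerRaceFree P O) {a : S.Adr} {σ : Comp S}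
    (hσ : IsComp P O {a} σ) : Safe σ := by
  have key : ∀ {act : Action S} {σ : Comp S}, IsComp P O {a} (act :: σ) →
      ¬ UnsafeAccess σ act := fun h hu =>
    hrace _ _ (Set.mem_iUnion.2 ⟨a, h⟩) (Or.inl hu)
  induction hσ with
  | nil => trivial
  | com t c up h1 h2 h3 ih => exact ⟨key (.com t c up h1 h2 h3), ih⟩
  | free t b h1 h2 ih => exact ⟨key (.free t b h1 h2), ih⟩

/-! ### Addresses that are never reused -/

/-- Invariants on an address that is never reused. -/
structure NotReused (σ : Comp S) (c : S.Adr) : Prop where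
  fresh : c ∈ fresh σ → (∀ e, (heap σ).ptr e ≠ some (.adr c)) ∧ PExp.sel c ∉ valid σ
  freed : c ∈ freed σ → (∀ e ∈ valid σ, (heap σ).ptr e ≠ some (.adr c)) ∧ PExp.sel c ∉ valid σ
  allocated : c ∉ SMR.fresh σ → c ∉ SMR.freed σ → ∀ e, (heap σ).ptr e = some (.adr c) → e ∈ valid σ

theorem mem_fresh_malloc {τ : Comp S} {t : S.Thread} {p : S.PVar} {a c : S.Adr} {d : S.Dom} :
    c ∈ fresh (⟨t, .com (.malloc p), [.ptr (.var p) (some (.adr a)),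
        .ptr (.sel a) (some .seg), .dat (.sel a) (some d)]⟩ :: τ) ↔ c ∈ fresh τ ∧ c ≠ a := by
  simp [fresh, eq_comm]

theorem mem_freed_malloc {τ : Comp S} {t : S.Thread} {p : S.PVar} {a c : S.Adr} {d : S.Dom} :
    c ∈ freed (⟨t, .com (.malloc p), [.ptr (.var p) (some (.adr a)),
        .ptr (.sel a) (some .seg), .dat (.sel a) (some d)]⟩ :: τ) ↔ c ∈ freed τ ∧ c ≠ a := by
  simp [freed, eq_comm]

/-- Dangling pointers to `c` arise only when `c` is freed, and `c` can never be allocated after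
that. A store cannot validate the selector of an unallocated `c`, because it goes through a valid
pointer. -/
theorem Exec.notReused {τ : Comp S} {t : S.Thread} {k : Com S} {up : List (Upd S)} {c : S.Adr}
    (hx : Exec X τ k up) (hs : Safe (⟨t, .com k, up⟩ :: τ)) (hc : c ∉ X) (h : NotReused τ c) :
    NotReused (⟨t, .com k, up⟩ :: τ) c := by
  obtain ⟨h1, h2, h3⟩ := h
  cases hx with
  | malloc p a d ha =>
    -- An allocation of `c ∉ X` must take `c` fresh, when nothing points to it; afterwards `p` is
    -- its only holder.
    have ha' : c = a → c ∈ fresh τ := by rintro rfl; simpa [hc] using ha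
    constructor <;> simp only [mem_valid_malloc, heap_cons, Mem.apply_cons, Mem.apply_nil,
      Mem.set_ptr_ptr, Mem.set_dat_ptr, mem_fresh_malloc, mem_freed_malloc] <;> grind
  | enter f ps xs => exact ⟨h1, h2, h3⟩
  | exit => exact ⟨h1, h2, h3⟩
  | ptrCopy p q =>
    constructor <;> simp only [mem_valid_ptrCopy, heap_cons, Mem.apply_cons, Mem.apply_nil,
      Mem.set_ptr_ptr, fresh, freed] <;> grind
  | ptrStore p q a ha =>
    have hp := hs.valid_of_derefs (p := p) rfl
    constructor <;> simp only [mem_valid_ptrStore ha, heap_cons, Mem.apply_cons, Mem.apply_nil,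
      Mem.set_ptr_ptr, fresh, freed] <;> grind
  | ptrLoad p q a ha =>
    constructor <;> simp only [mem_valid_ptrLoad ha, heap_cons, Mem.apply_cons, Mem.apply_nil,
      Mem.set_ptr_ptr, fresh, freed] <;> grind
  | datOp => exact ⟨h1, h2, h3⟩
  | datStore => exact ⟨h1, h2, h3⟩
  | datLoad => exact ⟨h1, h2, h3⟩
  | assert k hk =>
    cases k with
    | ptrEq p q =>
      simp only [Cond.Holds] at hk
      constructor <;> simp only [mem_valid_assert_ptrEq, heap_cons, Mem.apply_nil,
        fresh, freed] <;> grind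
    | _ => exact ⟨h1, h2, h3⟩

theorem IsComp.notReused {σ : Comp S} {c : S.Adr} (hσ : IsComp P O X σ) (hs : Safe σ)
    (hc : c ∉ X) : NotReused σ c := by
  induction hσ with
  | nil =>
    constructor
    · refine fun _ => ⟨?_, ?_⟩
      · rintro (p | a) <;> simp [heap, Mem.init]
      · simp [valid]
    · simp [freed]
    · simp [fresh]
  | com t k up _ _ hx ih => exact hx.notReused hs hc (ih hs.2)
  | free t a _ _ ih =>
    obtain ⟨h1, h2, h3⟩ := ih hs.2
    constructor <;> simp only [mem_valid_free, heap_cons, Mem.apply_cons, Mem.apply_nil,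
      Mem.set_ptr_ptr, Mem.set_dat_ptr, fresh, freed, Set.mem_sdiff, Set.mem_union,
      Set.mem_singleton_iff] <;> grind

/-! ### Behavior inclusion -/

/-- The event `e` is moved to the front of the continuation, which remains a behavior on `c` as `e`
frees at most `c`. -/
theorem freeable_append_mono {h h' : History S} {e : Event S} {c : S.Adr}
    (he : frees [e] ⊆ {c}) (hh : O.freeable h c ⊆ O.freeable h' c) :
    O.freeable (h ++ [e]) c ⊆ O.freeable (h' ++ [e]) c := by
  rintro k ⟨h1, h2⟩
  have := @hh (e :: k) ⟨by simpa using h1, by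
    intro b hb
    rcases List.mem_cons.1 hb with hb | hb
    · exact he (by simp [frees, hb])
    · exact h2 hb⟩
  exact ⟨by simpa using this.1, h2⟩

theorem frees_singleton_subset {e : Event S} (he : ∀ a, e ≠ .free a) (c : S.Adr) :
    frees [e] ⊆ {c} := by
  intro b hb
  exact absurd (List.mem_singleton.1 hb).symm (he b)

theorem history_enter {τ : Comp S} {t : S.Thread} {up : List (Upd S)} {f : S.Func}
    {ps : Fin (S.pArity f) → S.PVar} {xs : Fin (S.dArity f) → S.DVar}
    {as : Fin (S.pArity f) → S.Adr} {ds : Fin (S.dArity f) → S.Dom}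
    (ha : ∀ i, (heap τ).ptr (.var (ps i)) = some (.adr (as i)))
    (hd : ∀ j, (heap τ).dat (.var (xs j)) = some (ds j)) :
    history (⟨t, .com (.enter f ps xs), up⟩ :: τ) = history τ ++ [.call f t as ds] := by
  have ha' : ∀ i, (heap τ).adr? (ps i) = some (as i) := fun i => by simp [Mem.adr?, ha]
  simp [history, ha', hd]

theorem ctrl_com_congr {τ σ : Comp S} (h : ctrl P τ = ctrl P σ) (t : S.Thread) (c : Com S)
    (up up' : List (Upd S)) :
    ctrl P (⟨t, .com c, up⟩ :: τ) = ctrl P (⟨t, .com c, up'⟩ :: σ) := by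
  simp [ctrl, h]

/-! ### Corresponding computations -/

/-- Data selectors contribute nothing new, since the restriction keeps them only for addresses held
by valid pointers; valid selectors count because they are defined. -/
theorem mem_validAdr {τ : Comp S} (hτ : WellFormed τ) {c : S.Adr} :
    c ∈ validAdr τ ↔ c ∈ (heap τ).adrsAt (valid τ) ∨ PExp.sel c ∈ valid τ := by
  have h1 := hτ.defined (.sel c)
  simp only [validAdr, Mem.inUse, Mem.restrict, Set.mem_ofPred_eq, Mem.adrsAt]
  constructor
  · rintro (⟨e, he⟩ | he | he)
    · by_cases hv : e ∈ valid τ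
      · exact .inl ⟨e, hv, by simpa [hv] using he⟩
      · simp [hv] at he
    · exact .inr (by by_contra hv; simp [hv] at he)
    · exact .inl (by by_contra hv; simp [hv] at he)
  · rintro (⟨e, he, h⟩ | h)
    · exact .inl ⟨e, by simp [he, h]⟩
    · exact .inr (.inl (by simpa [h] using h1 h))

/-- The relations `∼`, `⋖` and `≡ₐ` between well-formed computations, spelled out. -/
structure Corr (P : Program.{u, v} S) (O : Observer.{u, w} S) (a : S.Adr) (τ σ : Comp S) :
    Prop where
  ctrl : ctrl P τ = ctrl P σ
  valid : ∀ e, e ∈ valid σ ↔ e ∈ SMR.valid τ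
  ptr : ∀ e ∈ SMR.valid τ, (heap σ).ptr e = (heap τ).ptr e
  datVar : ∀ x, (heap σ).dat (.var x) = (heap τ).dat (.var x)
  datSel : ∀ e ∈ SMR.valid τ, ∀ c, (heap τ).ptr e = some (.adr c) →
    (heap σ).dat (.sel c) = (heap τ).dat (.sel c)
  var : ∀ p, (heap τ).ptr (.var p) = some (.adr a) ↔ (heap σ).ptr (.var p) = some (.adr a)
  sel : ∀ e ∈ SMR.valid τ, ∀ c, (heap τ).ptr e = some (.adr c) →
    ((heap τ).ptr (.sel c) = some (.adr a) ↔ (heap σ).ptr (.sel c) = some (.adr a))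
  allocated : a ∈ fresh τ ∪ freed τ ↔ a ∈ fresh σ ∪ freed σ
  incl_self : InclOn O a τ σ
  incl_ptr : ∀ e ∈ SMR.valid τ, ∀ c, (heap τ).ptr e = some (.adr c) → InclOn O c τ σ
  incl_sel : ∀ c, PExp.sel c ∈ SMR.valid τ → InclOn O c τ σ

/-- Valid expressions are defined, so the domain of the restricted memory is exactly the valid set;
equal restrictions thus force equal validity. -/
theorem corr_of_rel {a : S.Adr} {τ σ : Comp S} (hτ : WellFormed τ) (hσ : WellFormed σ)
    (hs : Similar P τ σ) (ho : ObsIncl O τ σ) (hm : MemEquiv O a τ σ) : Corr P O a τ σ := by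
  have hp := fun e => congrFun (congrArg Mem.ptr hs.2) e
  have hd := fun e => congrFun (congrArg Mem.dat hs.2) e
  simp only [Mem.restrict] at hp
  have hv : ∀ e, e ∈ valid σ ↔ e ∈ valid τ := by
    intro e
    have h1 := hp e
    have h2 := hτ.defined e
    have h3 := hσ.defined e
    constructor <;> intro h <;> by_contra h' <;> simp_all
  have hp' : ∀ e ∈ valid τ, (heap σ).ptr e = (heap τ).ptr e := by
    intro e he
    have := hp e
    simp only [hv, he, if_true] at this
    exact this.symm
  refine ⟨hs.1, hv, hp', fun x => (hd (.var x)).symm, ?_, hm.1,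
    fun e he c hc => hm.2.1 c ⟨e, he, hc⟩, hm.2.2.1, hm.2.2.2,
    fun e he c hc => ho c ((mem_validAdr hτ).2 (.inl ⟨e, he, hc⟩)),
    fun c hc => ho c ((mem_validAdr hτ).2 (.inr hc))⟩
  intro e he c hc
  have h1 : c ∈ (heap τ).adrsAt (valid τ) := ⟨e, he, hc⟩
  have h2 : c ∈ (heap σ).adrsAt (valid σ) := ⟨e, (hv e).2 he, (hp' e he).trans hc⟩
  have := hd (.sel c)
  simp only [Mem.restrict, h1, h2, if_true] at this
  exact this.symm

namespace Corr

variable {a : S.Adr} {τ σ : Comp S}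

theorem similar (h : Corr P O a τ σ) : Similar P τ σ := by
  refine ⟨h.ctrl, Mem.ext (funext fun e => ?_) (funext fun e => ?_)⟩
  · have hv := h.valid e
    by_cases he : e ∈ SMR.valid τ
    · simp only [Mem.restrict, he, hv.2 he, if_true, h.ptr e he]
    · simp only [Mem.restrict, he, mt hv.1 he, if_false]
  · cases e with
    | var x => exact (h.datVar x).symm
    | sel c =>
      have hr : c ∈ (heap σ).adrsAt (SMR.valid σ) ↔ c ∈ (heap τ).adrsAt (SMR.valid τ) :=
        exists_congr fun e => by rw [h.valid]; exact and_congr_right fun he => by rw [h.ptr e he]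
      by_cases hc : c ∈ (heap τ).adrsAt (SMR.valid τ)
      · have ⟨e, he, hec⟩ := hc
        simp only [Mem.restrict, hc, hr.2 hc, if_true, h.datSel e he c hec]
      · simp only [Mem.restrict, hc, mt hr.1 hc, if_false]

theorem obsIncl (h : Corr P O a τ σ) (hτ : WellFormed τ) : ObsIncl O τ σ := by
  intro c hc
  rcases (mem_validAdr hτ).1 hc with ⟨e, he, hc⟩ | hc
  · exact h.incl_ptr e he c hc
  · exact h.incl_sel c hc

theorem memEquiv (h : Corr P O a τ σ) : MemEquiv O a τ σ :=
  ⟨h.var, fun _ ⟨e, he, hc⟩ => h.sel e he _ hc, h.allocated, h.incl_self⟩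

/-! ### Commands that a corresponding computation can mimic -/

section Step

variable {t : S.Thread}

/-- If `q` is invalid, its values may differ, but `var` makes them agree on being `a`, which is all
that is required of an invalid `p`. -/
theorem ptrCopy (h : Corr P O a τ σ) (p q : S.PVar) :
    Corr P O a (⟨t, .com (.ptrCopy p q), [.ptr (.var p) ((heap τ).ptr (.var q))]⟩ :: τ)
      (⟨t, .com (.ptrCopy p q), [.ptr (.var p) ((heap σ).ptr (.var q))]⟩ :: σ) := by
  obtain ⟨h1, h2, h3, h4, h5, h6, h7, h8, h9, h10, h11⟩ := h
  refine ⟨ctrl_com_congr h1 .., ?_, ?_, ?_, ?_, ?_, ?_, h8, h9, ?_, ?_⟩ <;>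
    simp only [mem_valid_ptrCopy, heap_cons, Mem.apply_cons, Mem.apply_nil, Mem.set_ptr_ptr,
      Mem.set_ptr_dat, InclOn, history] <;> simp only [InclOn] at h9 h10 h11 <;> grind

theorem ptrStore (h : Corr P O a τ σ) {p q : S.PVar} {b : S.Adr} (hp : PExp.var p ∈ SMR.valid τ)
    (hb : (heap τ).ptr (.var p) = some (.adr b)) :
    Corr P O a (⟨t, .com (.ptrStore p q), [.ptr (.sel b) ((heap τ).ptr (.var q))]⟩ :: τ)
      (⟨t, .com (.ptrStore p q), [.ptr (.sel b) ((heap σ).ptr (.var q))]⟩ :: σ) := by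
  obtain ⟨h1, h2, h3, h4, h5, h6, h7, h8, h9, h10, h11⟩ := h
  have hb' := (h3 _ hp).trans hb
  refine ⟨ctrl_com_congr h1 .., ?_, ?_, ?_, ?_, ?_, ?_, h8, h9, ?_, ?_⟩ <;>
    simp only [mem_valid_ptrStore hb, mem_valid_ptrStore hb', heap_cons, Mem.apply_cons,
      Mem.apply_nil, Mem.set_ptr_ptr, Mem.set_ptr_dat, InclOn, history] <;>
    simp only [InclOn] at h9 h10 h11 <;> grind

/-- Even if `q.next` is invalid, the clause `sel` applies, because `q` itself is valid. -/
theorem ptrLoad (h : Corr P O a τ σ) {p q : S.PVar} {b : S.Adr} (hq : PExp.var q ∈ SMR.valid τ)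
    (hb : (heap τ).ptr (.var q) = some (.adr b)) :
    Corr P O a (⟨t, .com (.ptrLoad p q), [.ptr (.var p) ((heap τ).ptr (.sel b))]⟩ :: τ)
      (⟨t, .com (.ptrLoad p q), [.ptr (.var p) ((heap σ).ptr (.sel b))]⟩ :: σ) := by
  obtain ⟨h1, h2, h3, h4, h5, h6, h7, h8, h9, h10, h11⟩ := h
  have hb' := (h3 _ hq).trans hb
  refine ⟨ctrl_com_congr h1 .., ?_, ?_, ?_, ?_, ?_, ?_, h8, h9, ?_, ?_⟩ <;>
    simp only [mem_valid_ptrLoad hb, mem_valid_ptrLoad hb', heap_cons, Mem.apply_cons,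
      Mem.apply_nil, Mem.set_ptr_ptr, Mem.set_ptr_dat, InclOn, history] <;>
    simp only [InclOn] at h9 h10 h11 <;> grind

/-- The newly valid address is `a`, for which `incl_self` provides behavior inclusion; another
address might lack it. -/
theorem malloc_self (h : Corr P O a τ σ) (p : S.PVar) (d : S.Dom) :
    Corr P O a
      (⟨t, .com (.malloc p), [.ptr (.var p) (some (.adr a)), .ptr (.sel a) (some .seg),
        .dat (.sel a) (some d)]⟩ :: τ)
      (⟨t, .com (.malloc p), [.ptr (.var p) (some (.adr a)), .ptr (.sel a) (some .seg),
        .dat (.sel a) (some d)]⟩ :: σ) := by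
  obtain ⟨h1, h2, h3, h4, h5, h6, h7, h8, h9, h10, h11⟩ := h
  refine ⟨ctrl_com_congr h1 .., ?_, ?_, ?_, ?_, ?_, ?_, ?_, h9, ?_, ?_⟩ <;>
    simp only [mem_valid_malloc, heap_cons, Mem.apply_cons, Mem.apply_nil, Mem.set_ptr_ptr,
      Mem.set_ptr_dat, Mem.set_dat_dat, Mem.set_dat_ptr, InclOn, history, Set.mem_union,
      mem_fresh_malloc, mem_freed_malloc] <;> simp only [InclOn] at h9 h10 h11 <;> grind

/-- Steps that change neither validity nor pointers nor the history. -/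
theorem of_dat (h : Corr P O a τ σ) {act act' : Action S}
    (hc : SMR.ctrl P (act :: τ) = SMR.ctrl P (act' :: σ))
    (hv : SMR.valid (act :: τ) = SMR.valid τ) (hv' : SMR.valid (act' :: σ) = SMR.valid σ)
    (hp : (heap (act :: τ)).ptr = (heap τ).ptr) (hp' : (heap (act' :: σ)).ptr = (heap σ).ptr)
    (hx : ∀ x, (heap (act' :: σ)).dat (.var x) = (heap (act :: τ)).dat (.var x))
    (hs : ∀ e ∈ SMR.valid τ, ∀ c, (heap τ).ptr e = some (.adr c) →
      (heap (act' :: σ)).dat (.sel c) = (heap (act :: τ)).dat (.sel c))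
    (hf : fresh (act :: τ) ∪ freed (act :: τ) = fresh τ ∪ freed τ)
    (hf' : fresh (act' :: σ) ∪ freed (act' :: σ) = fresh σ ∪ freed σ)
    (hi : ∀ c, InclOn O c τ σ → (c = a ∨ c ∈ (heap τ).adrsAt (SMR.valid τ) ∨
      PExp.sel c ∈ SMR.valid τ) → InclOn O c (act :: τ) (act' :: σ)) :
    Corr P O a (act :: τ) (act' :: σ) := by
  obtain ⟨h1, h2, h3, h4, h5, h6, h7, h8, h9, h10, h11⟩ := h
  refine ⟨hc, ?_, ?_, hx, ?_, ?_, ?_, ?_, hi a h9 (.inl rfl), ?_, ?_⟩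
  · rwa [hv, hv']
  · rwa [hv, hp, hp']
  · rwa [hv, hp]
  · rwa [hp, hp']
  · rwa [hv, hp, hp']
  · rwa [hf, hf']
  · rw [hv, hp]
    exact fun e he c hc => hi c (h10 e he c hc) (.inr (.inl ⟨e, he, hc⟩))
  · rw [hv]
    exact fun c hc => hi c (h11 c hc) (.inr (.inr hc))

/-- An equality can validate a variable only if the other one is valid; the new one has the same
value and inherits all its clauses. -/
theorem assert (h : Corr P O a τ σ) {c : Cond S} (hc : c.Holds (heap τ)) (hc' : c.Holds (heap σ)) :
    Corr P O a (⟨t, .com (.assert c), []⟩ :: τ) (⟨t, .com (.assert c), []⟩ :: σ) := by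
  cases c with
  | ptrEq p q =>
    obtain ⟨h1, h2, h3, h4, h5, h6, h7, h8, h9, h10, h11⟩ := h
    simp only [Cond.Holds] at hc hc'
    refine ⟨ctrl_com_congr h1 .., ?_, ?_, ?_, ?_, ?_, ?_, h8, h9, ?_, ?_⟩ <;>
      simp only [mem_valid_assert_ptrEq, heap_cons, Mem.apply_nil, InclOn, history] <;>
      simp only [InclOn] at h9 h10 h11 <;> grind
  | _ =>
    exact h.of_dat (ctrl_com_congr h.ctrl ..) rfl rfl rfl rfl h.datVar h.datSel rfl rfl
      fun _ hi _ => hi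

theorem free (h : Corr P O a τ σ) (t' : S.Thread) (b : S.Adr)
    (hO : ∀ (h : History S) (a b : S.Adr), a ≠ b →
      O.freeable (h ++ [.free a]) b = O.freeable h b) :
    Corr P O a (⟨t, .free b, [.ptr (.sel b) none, .dat (.sel b) none]⟩ :: τ)
      (⟨t', .free b, [.ptr (.sel b) none, .dat (.sel b) none]⟩ :: σ) := by
  have hi : ∀ c, InclOn O c τ σ →
      InclOn O c (⟨t, .free b, [.ptr (.sel b) none, .dat (.sel b) none]⟩ :: τ)
        (⟨t', .free b, [.ptr (.sel b) none, .dat (.sel b) none]⟩ :: σ) := by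
    intro c hc
    simp only [InclOn, history]
    by_cases hcb : b = c
    · subst hcb
      exact freeable_append_mono (by simp [frees]) hc
    · rw [hO _ _ _ hcb, hO _ _ _ hcb]
      exact hc
  obtain ⟨h1, h2, h3, h4, h5, h6, h7, h8, h9, h10, h11⟩ := h
  refine ⟨?_, ?_, ?_, ?_, ?_, ?_, ?_, ?_, hi a h9, ?_, ?_⟩
  · simpa [SMR.ctrl] using h1
  all_goals
    simp only [mem_valid_free, heap_cons, Mem.apply_cons, Mem.apply_nil, Mem.set_ptr_ptr,
      Mem.set_ptr_dat, Mem.set_dat_dat, Mem.set_dat_ptr, Set.mem_union, fresh, freed,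
      Set.mem_sdiff, Set.mem_singleton_iff] at h8 ⊢
    grind

/-- Here only `τ` frees `b`. As `b` is not a valid address, valid memory is unaffected, and the
extra event is invisible on every tracked address, all of which differ from `b`. -/
theorem free_left (h : Corr P O a τ σ) {b : S.Adr} (hba : b ≠ a)
    (hb : ∀ e ∈ SMR.valid τ, (heap τ).ptr e ≠ some (.adr b)) (hb' : PExp.sel b ∉ SMR.valid τ)
    (hO : ∀ (h : History S) (a b : S.Adr), a ≠ b →
      O.freeable (h ++ [.free a]) b = O.freeable h b) :
    Corr P O a (⟨t, .free b, [.ptr (.sel b) none, .dat (.sel b) none]⟩ :: τ) σ := by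
  have hi : ∀ c, b ≠ c → InclOn O c τ σ →
      InclOn O c (⟨t, .free b, [.ptr (.sel b) none, .dat (.sel b) none]⟩ :: τ) σ := by
    intro c hcb hc
    simp only [InclOn, history]
    rw [hO _ _ _ hcb]
    exact hc
  obtain ⟨h1, h2, h3, h4, h5, h6, h7, h8, h9, h10, h11⟩ := h
  refine ⟨?_, ?_, ?_, ?_, ?_, ?_, ?_, ?_, hi a hba h9, ?_, ?_⟩
  · simpa [SMR.ctrl] using h1
  all_goals
    simp only [mem_valid_free, heap_cons, Mem.apply_cons, Mem.apply_nil, Mem.set_ptr_ptr,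
      Mem.set_ptr_dat, Mem.set_dat_dat, Mem.set_dat_ptr, Set.mem_union, fresh, freed,
      Set.mem_sdiff, Set.mem_singleton_iff] at h8 ⊢
    grind

end Step

end Corr

/-! ### Calls, returns, data commands and conditions -/

namespace Corr

variable {a : S.Adr} {τ σ : Comp S} {t : S.Thread}

/-- The inclusion has two stages: the call with the arguments `as` of `τ` is appended to both
histories, and then `as` is replaced by the arguments `bs` of `σ`, which is sound since the call is
not racy. -/
theorem enter (h : Corr P O a τ σ) {f : S.Func} {ps : Fin (S.pArity f) → S.PVar}
    {xs : Fin (S.dArity f) → S.DVar} {as bs : Fin (S.pArity f) → S.Adr}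
    {ds : Fin (S.dArity f) → S.Dom}
    (ha : ∀ i, (heap τ).ptr (.var (ps i)) = some (.adr (as i)))
    (hb : ∀ i, (heap σ).ptr (.var (ps i)) = some (.adr (bs i)))
    (hd : ∀ j, (heap τ).dat (.var (xs j)) = some (ds j))
    (hn : ∀ c, c ≠ a → NotReused σ c)
    (hr : ¬ RacyCall O σ ⟨t, .com (.enter f ps xs), []⟩) :
    Corr P O a (⟨t, .com (.enter f ps xs), []⟩ :: τ) (⟨t, .com (.enter f ps xs), []⟩ :: σ) := by
  have hd' : ∀ j, (heap σ).dat (.var (xs j)) = some (ds j) := fun j => (h.datVar _).trans (hd j)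
  refine h.of_dat (ctrl_com_congr h.ctrl ..) rfl rfl rfl rfl h.datVar h.datSel rfl rfl
    fun c hi hc => ?_
  rw [InclOn, history_enter ha hd, history_enter hb hd']
  refine (freeable_append_mono (frees_singleton_subset (by simp) c) hi).trans ?_
  by_contra hsub
  refine hr ⟨f, ps, xs, bs, ds, rfl, hb, hd', c, as, ?_, hsub⟩
  have hval : ∀ i, PExp.var (ps i) ∈ SMR.valid σ → bs i = as i := by
    intro i hi
    have := h.ptr _ ((h.valid _).1 hi)
    rw [hb, ha] at this
    simpa using this
  rintro i (hi | hi)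
  · by_cases hca : c = a
    · subst hca hi
      have := (h.var (ps i)).2 (hb i)
      rw [ha] at this
      simpa using this.symm
    · refine hval i ?_
      -- Here `c ≠ a` is a valid address, so it is neither fresh nor freed in `σ`; being never
      -- reused, it has only valid pointers, among them `ps i`.
      have hc' : (∃ e ∈ SMR.valid σ, (heap σ).ptr e = some (.adr c)) ∨
          PExp.sel c ∈ SMR.valid σ := by
        rcases hc with hc | ⟨e, he, hc⟩ | hc
        · exact absurd hc hca
        · exact .inl ⟨e, (h.valid e).2 he, (h.ptr e he).trans hc⟩
        · exact .inr ((h.valid _).2 hc)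
      refine (hn c hca).allocated (fun hf => ?_) (fun hf => ?_) _ (hi ▸ hb i)
      · have := (hn c hca).fresh hf
        grind
      · have := (hn c hca).freed hf
        grind
  · exact hval i hi

theorem exit (h : Corr P O a τ σ) :
    Corr P O a (⟨t, .com .exit, []⟩ :: τ) (⟨t, .com .exit, []⟩ :: σ) :=
  h.of_dat (ctrl_com_congr h.ctrl ..) rfl rfl rfl rfl h.datVar h.datSel rfl rfl
    fun c hi _ => freeable_append_mono (frees_singleton_subset (by simp) c) hi

theorem datOp (h : Corr P O a τ σ) {x : S.DVar} {op : List S.Dom → S.Dom} {ys : List S.DVar}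
    {d : Option S.Dom} :
    Corr P O a (⟨t, .com (.datOp x op ys), [.dat (.var x) d]⟩ :: τ)
      (⟨t, .com (.datOp x op ys), [.dat (.var x) d]⟩ :: σ) :=
  h.of_dat (ctrl_com_congr h.ctrl ..) rfl rfl rfl rfl
    (fun y => by simp [h.datVar]) (fun e he c hc => by simpa using h.datSel e he c hc) rfl rfl
    fun _ hi _ => hi

theorem datStore (h : Corr P O a τ σ) {p : S.PVar} {y : S.DVar} {b : S.Adr} :
    Corr P O a (⟨t, .com (.datStore p y), [.dat (.sel b) ((heap τ).dat (.var y))]⟩ :: τ)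
      (⟨t, .com (.datStore p y), [.dat (.sel b) ((heap σ).dat (.var y))]⟩ :: σ) :=
  h.of_dat (ctrl_com_congr h.ctrl ..) rfl rfl rfl rfl
    (fun x => by simp [h.datVar])
    (fun e he c hc => by simp [h.datVar, h.datSel e he c hc]) rfl rfl fun _ hi _ => hi

theorem datLoad (h : Corr P O a τ σ) {x : S.DVar} {q : S.PVar} {b : S.Adr}
    (hq : PExp.var q ∈ SMR.valid τ) (hb : (heap τ).ptr (.var q) = some (.adr b)) :
    Corr P O a (⟨t, .com (.datLoad x q), [.dat (.var x) ((heap τ).dat (.sel b))]⟩ :: τ)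
      (⟨t, .com (.datLoad x q), [.dat (.var x) ((heap σ).dat (.sel b))]⟩ :: σ) :=
  h.of_dat (ctrl_com_congr h.ctrl ..) rfl rfl rfl rfl
    (fun y => by simp [h.datVar, h.datSel _ hq b hb])
    (fun e he c hc => by simpa using h.datSel e he c hc) rfl rfl fun _ hi _ => hi

theorem refl_nil : Corr P O a [] [] := by
  constructor <;> intros <;> first | rfl | exact Iff.rfl | exact subset_rfl

/-- If `c` holds after `τ`, then it holds in a suitable corresponding computation. -/
theorem holds_or_exists {c : Cond S} (hτ : WellFormed τ) (hc : c.Holds (heap τ)) :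
    (∀ a σ, Corr P O a τ σ → WellFormed σ → c.Holds (heap σ)) ∨
      ∃ b, ∀ σ, Corr P O b τ σ → c.Holds (heap σ) := by
  cases c with
  | ptrEq p q =>
    simp only [Cond.Holds] at hc ⊢
    -- Variables holding `seg` are valid and keep their value in every `σ`; if the common value is
    -- an address `b`, the computation for `b` tracks it exactly.
    rcases hp : (heap τ).ptr (.var p) with _ | (_ | b)
    · exact absurd hp (hτ.var p)
    · refine .inl fun a σ h _ => ?_
      rw [h.ptr _ (hτ.seg _ hp), h.ptr _ (hτ.seg _ (hc ▸ hp)), hc]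
    · exact .inr ⟨b, fun σ h => ((h.var p).1 hp).trans ((h.var q).1 (hc ▸ hp)).symm⟩
  | ptrNe p q =>
    simp only [Cond.Holds] at hc ⊢
    rcases hp : (heap τ).ptr (.var p) with _ | (_ | b)
    · exact absurd hp (hτ.var p)
    · refine .inl fun a σ h hσ hpq => hc ?_
      -- If `p` and `q` coincided in `σ`, then `q` would hold `seg` there and so be valid, with the
      -- same value in `τ`.
      have hs := (h.ptr _ (hτ.seg _ hp)).trans hp
      have hq := (h.valid _).1 (hσ.seg _ (hpq ▸ hs))
      rw [← h.ptr _ (hτ.seg _ hp), ← h.ptr _ hq, hpq]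
    · exact .inr ⟨b, fun σ h hpq => hc (hp.trans
        ((h.var q).2 (hpq ▸ (h.var p).1 hp)).symm)⟩
  | datEq x y => exact .inl fun a σ h _ => by simpa [Cond.Holds, h.datVar] using hc
  | datNe x y => exact .inl fun a σ h _ => by simpa [Cond.Holds, h.datVar] using hc
  | datLt x y => exact .inl fun a σ h _ => by simpa [Cond.Holds, h.datVar] using hc

end Corr

/-! ### The reduction -/

theorem IsComp.wellFormed_of_raceFree (hrace : PointerRaceFree P O) {a : S.Adr} {σ : Comp S}
    (hσ : IsComp P O {a} σ) : WellFormed σ :=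
  hσ.wellFormed (safe_of_pointerRaceFree hrace hσ)

/-- If the invalid `r` holds `b`, it also holds `b` in the computation for `b`, where the same
command is enabled and would be a pointer race. -/
theorem not_unsafeAccess_of_corr (hrace : PointerRaceFree P O) {τ : Comp S} {t : S.Thread}
    {c : Com S} {up : List (Upd S)}
    (ih : ∀ a, ∃ σ, IsComp P O {a} σ ∧ Corr P O a τ σ)
    (hn : (P.next t (ctrl P τ t) c).isSome) (hx : Exec Set.univ τ c up) :
    ¬ UnsafeAccess τ ⟨t, .com c, up⟩ := by
  rintro ⟨_, r, ⟨⟩, hr, hv⟩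
  have key : ∀ b, (heap τ).ptr (.var r) = some (.adr b) →
      ¬ ∀ σ : Comp S, (heap σ).ptr (.var r) = some (.adr b) → ∃ up', Exec {b} σ c up' := by
    intro b hb h
    obtain ⟨σ, hσ, hc⟩ := ih b
    obtain ⟨up', hx'⟩ := h σ ((hc.var r).1 hb)
    refine hrace σ ⟨t, .com c, up'⟩ (Set.mem_iUnion.2 ⟨b, .com t c up' hσ ?_ hx'⟩) (.inl ?_)
    · rwa [← hc.ctrl]
    · exact ⟨c, r, rfl, hr, by rwa [hc.valid]⟩
  cases hx with
  | ptrStore p q b hb =>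
    cases hr; exact key b hb fun σ h => ⟨_, .ptrStore _ _ b h⟩
  | ptrLoad p q b hb =>
    cases hr; exact key b hb fun σ h => ⟨_, .ptrLoad _ _ b h⟩
  | datStore p y b hb =>
    cases hr; exact key b hb fun σ h => ⟨_, .datStore _ _ b h⟩
  | datLoad x q b hb =>
    cases hr; exact key b hb fun σ h => ⟨_, .datLoad _ _ b h⟩
  | _ => exact hr

/-- Transfer of an assertion or allocation from one corresponding computation to another. -/
theorem exists_corr_of_compatible (hcompat : ReductionCompatible P O)
    (hrace : PointerRaceFree P O) {τ σa σb : Comp S} {act : Action S} {a b : S.Adr}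
    (hτ : IsComp P O Set.univ (act :: τ)) (hs : Safe (act :: τ)) (hτ' : IsComp P O Set.univ τ)
    (ha : IsComp P O {a} (act :: σa)) (hca : Corr P O a τ σa)
    (hca' : Corr P O a (act :: τ) (act :: σa)) (hb : IsComp P O {b} σb) (hcb : Corr P O b τ σb)
    (hact : AssertOrMalloc a act) :
    ∃ σ, IsComp P O {b} σ ∧ Corr P O b (act :: τ) σ := by
  by_cases hab : a = b
  · subst hab
    exact ⟨_, ha, hca'⟩
  have w := hτ'.wellFormed hs.2
  have w' := hτ.wellFormed hs
  obtain ⟨σ, hσ, h1, h2, h3⟩ := hcompat.1 a b act τ σa σb hτ ha hb hca.similar (hca.obsIncl w)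
    hca.memEquiv hca'.similar (hca'.obsIncl w') hca'.memEquiv hcb.similar (hcb.obsIncl w)
    hcb.memEquiv ⟨hca.similar.1.symm.trans hcb.similar.1,
      hca.similar.2.symm.trans hcb.similar.2⟩ hab hact
  exact ⟨σ, hσ, corr_of_rel w' (hσ.wellFormed_of_raceFree hrace) h1 h2 h3⟩

theorem exists_corr_com (hcompat : ReductionCompatible P O) (hrace : PointerRaceFree P O)
    {τ : Comp S} {t : S.Thread} {c : Com S} {up : List (Upd S)}
    (hτ : IsComp P O Set.univ τ) (hs : Safe (⟨t, .com c, up⟩ :: τ))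
    (ih : ∀ a, ∃ σ, IsComp P O {a} σ ∧ Corr P O a τ σ)
    (hn : (P.next t (ctrl P τ t) c).isSome) (hx : Exec Set.univ τ c up) (a : S.Adr) :
    ∃ σ, IsComp P O {a} σ ∧ Corr P O a (⟨t, .com c, up⟩ :: τ) σ := by
  have hw := hτ.wellFormed hs.2
  have hτ' : IsComp P O Set.univ (⟨t, .com c, up⟩ :: τ) := .com t c up hτ hn hx
  obtain ⟨σ, hσ, h⟩ := ih a
  have hwσ := hσ.wellFormed_of_raceFree hrace
  have step : ∀ {b σ up'}, IsComp P O {b} σ → Corr P O b τ σ → Exec {b} σ c up' →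
      IsComp P O {b} (⟨t, .com c, up'⟩ :: σ) := fun hσ h hx' =>
    .com t c _ hσ (by rwa [← h.ctrl]) hx'
  cases hx with
  | malloc p b d hb =>
    -- The computation for `a` may be unable to allocate `b`; the one for `b` may reuse it.
    obtain ⟨σb, hσb, hcb⟩ := ih b
    have hb' : b ∈ fresh τ ∪ freed τ := by simpa using hb
    have hx' : Exec {b} σb (.malloc p) _ :=
      .malloc p b d (by simpa using hcb.allocated.1 hb')
    exact exists_corr_of_compatible hcompat hrace hτ' hs hτ (step hσb hcb hx') hcb
      (hcb.malloc_self p d) hσ h (.inr ⟨p, rfl, by simp⟩)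
  | enter f ps xs hp hd =>
    choose as has using hp
    choose ds hds using hd
    -- A parameter holding `seg` in `σ` would be valid and hold `seg` in `τ` as well.
    have hb : ∀ i, ∃ b, (heap σ).ptr (.var (ps i)) = some (.adr b) := by
      intro i
      rcases hi : (heap σ).ptr (.var (ps i)) with _ | (_ | b)
      · exact absurd hi (hwσ.var _)
      · have := h.ptr _ ((h.valid _).1 (hwσ.seg _ hi))
        rw [hi, has] at this
        simp at this
      · exact ⟨b, rfl⟩
    have hx' : Exec {a} σ (.enter f ps xs) [] :=
      .enter f ps xs hb fun j => ⟨ds j, (h.datVar _).trans (hds j)⟩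
    choose bs hbs using hb
    have hσ' := step hσ h hx'
    refine ⟨_, hσ', h.enter has hbs hds (fun c hc => ?_) fun hr => ?_⟩
    · exact hσ.notReused (safe_of_pointerRaceFree hrace hσ) (by simpa using hc)
    · exact hrace _ _ (Set.mem_iUnion.2 ⟨a, hσ'⟩) (.inr hr)
  | exit => exact ⟨_, step hσ h .exit, h.exit⟩
  | ptrCopy p q => exact ⟨_, step hσ h (.ptrCopy p q), h.ptrCopy p q⟩
  | ptrStore p q b hb =>
    have hp := hs.valid_of_derefs (p := p) rfl
    exact ⟨_, step hσ h (.ptrStore p q b ((h.ptr _ hp).trans hb)), h.ptrStore hp hb⟩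
  | ptrLoad p q b hb =>
    have hq := hs.valid_of_derefs (p := q) rfl
    exact ⟨_, step hσ h (.ptrLoad p q b ((h.ptr _ hq).trans hb)), h.ptrLoad hq hb⟩
  | datOp x op ys ds hd =>
    exact ⟨_, step hσ h (.datOp x op ys ds (by simpa only [h.datVar] using hd)), h.datOp⟩
  | datStore p y b hb =>
    have hp := hs.valid_of_derefs (p := p) rfl
    exact ⟨_, step hσ h (.datStore p y b ((h.ptr _ hp).trans hb)), h.datStore⟩
  | datLoad x q b hb =>
    have hq := hs.valid_of_derefs (p := q) rfl
    exact ⟨_, step hσ h (.datLoad x q b ((h.ptr _ hq).trans hb)), h.datLoad hq hb⟩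
  | assert c hc =>
    rcases Corr.holds_or_exists (P := P) (O := O) hw hc with hall | ⟨b, hb⟩
    · have hc' := hall a σ h hwσ
      exact ⟨_, step hσ h (.assert c hc'), h.assert hc hc'⟩
    · obtain ⟨σb, hσb, hcb⟩ := ih b
      have hc' := hb σb hcb
      exact exists_corr_of_compatible hcompat hrace hτ' hs hτ (step hσb hcb (.assert c hc')) hcb
        (hcb.assert hc hc') hσ h (.inl ⟨c, rfl⟩)

/-- Both claims go through one induction: safety of the next action comes from the corresponding
computations, and mimicking that action needs its safety. -/
theorem safe_and_exists_corr (hcompat : ReductionCompatible P O) (hrace : PointerRaceFree P O)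
    {τ : Comp S} (hτ : IsComp P O Set.univ τ) :
    Safe τ ∧ ∀ a, ∃ σ, IsComp P O {a} σ ∧ Corr P O a τ σ := by
  induction hτ with
  | nil => exact ⟨trivial, fun a => ⟨[], .nil, .refl_nil⟩⟩
  | com t c up hτ hn hx ih =>
    have hs : Safe (⟨t, .com c, up⟩ :: _) := ⟨not_unsafeAccess_of_corr hrace ih.2 hn hx, ih.1⟩
    exact ⟨hs, exists_corr_com hcompat hrace hτ hs ih.2 hn hx⟩
  | @free τ t b hτ hO ih =>
    refine ⟨⟨fun ⟨_, _, h, _⟩ => by simp at h, ih.1⟩, fun a => ?_⟩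
    obtain ⟨σ, hσ, h⟩ := ih.2 a
    -- With inclusion on `b`, the one-event continuation `free(b)` carries over to `σ`. Without it,
    -- the inclusion clauses of `Corr` show that `b ≠ a` and that `b` is not a valid address.
    by_cases hb : InclOn O b τ σ
    · have := (hb ⟨hO, by simp [frees]⟩).1
      exact ⟨_, .free t b hσ this, h.free t b hcompat.2⟩
    · refine ⟨σ, hσ, h.free_left ?_ ?_ ?_ hcompat.2⟩
      · rintro rfl
        exact hb h.incl_self
      · exact fun e he hc => hb (h.incl_ptr e he b hc)
      · exact fun hc => hb (h.incl_sel b hc)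

end SMR

theorem mainTheorem5 (S : SMR.Signature.{u}) (P : SMR.Program.{u, v} S)
    (O : SMR.Observer.{u, w} S)
    (hcompat : SMR.ReductionCompatible P O) (hrace : SMR.PointerRaceFree P O) :
    ∀ τ ∈ SMR.fullSem P O, ∀ a : S.Adr,
      ∃ σ ∈ SMR.oneSem P O,
        SMR.Similar P τ σ ∧ SMR.MemEquiv O a τ σ ∧
          SMR.ObsIncl O τ σ ∧ SMR.InclOn O a τ σ := by
  intro τ hτ a
  obtain ⟨hs, h⟩ := SMR.safe_and_exists_corr hcompat hrace hτ
  obtain ⟨σ, hσ, hc⟩ := h a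
  exact ⟨σ, Set.mem_iUnion.2 ⟨a, hσ⟩, hc.similar, hc.memEquiv, hc.obsIncl (hτ.wellFormed hs),
    hc.incl_self⟩
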